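/- Let $\mathcal C$ be a strongly semi-abelian category, that is: $\mathcal C$ is pointed, Barr exact (finitely complete, regular epimorphisms are stable under pullback, kernel pairs have coequalizers, and every internal equivalence relation is a kernel pair), has finite coproducts, and is strongly protomodular. The last condition means the following. For each object $A$ let $\mathrm{Pt}_A(\mathcal C)$ be the category of split epimorphisms $p\colon B\to A$ with a chosen section $s$, with the morphisms over $A$ that commute with the sections, and let $\mathrm{Ker}_A\colon\mathrm{Pt}_A(\mathcal C)\to\mathcal C$ be the functor $(B,p,s)\mapsto\mathrm{Ker}(p)$; it is left exact. Then every $\mathrm{Ker}_A$ reflects isomorphisms and reflects normal monomorphisms, where a monomorphism $f\colon X\to Y$ of a pointed finitely complete category is normal if it is the zero class of an internal equivalence relation $(r_1,r_2)\colon R\rightrightarrows Y$, i.e. $f=r_1\cdot\ker(r_2)$. For objects $A,X$ of $\mathcal C$ let $\kappa_{A,X}\colon A\flat X\to A+X$ be the kernel of $[1,0]\colon A+X\to A$. The functor $A\flat(-)$ is the underlying functor of the monad on $\mathcal C$ induced by the adjunction between $X\mapsto(A+X\rightleftarrows A)$ and $\mathrm{Ker}_A$. An (internal) $A$-action on $Y$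 is a morphism $\xi\colon A\flat Y\to Y$ making $Y$ an algebra for this monad. For $a\colon A\to B$ let $a\flat 1\colon A\flat Y\to B\flat Y$ be the morphism induced on kernels by $a+1$. The trivial $A$-action on $Y$ is $\rho_{A,Y}=[0,1]\cdot\kappa_{A,Y}\colon A\flat Y\to Y$. Let $K\xrightarrow{k}A\xrightarrow{q}Q$ be a short exact sequence in $\mathcal C$ (that is, $q$ is a regular epimorphism and $k$ is a kernel of $q$), and let $\xi\colon A\flat Y\to Y$ be an $A$-action on an object $Y$. Then the following conditions are equivalent: 1. $\xi\cdot(k\flat 1)=\rho_{K,Y}$, the trivial $K$-action on $Y$; 2. there exists a $Q$-action $q_*(\xi)\colon Q\flat Y\to Y$ on $Y$ such that $\xi=q_*(\xi)\cdot(q\flat 1)$. -/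

import Mathlib

open CategoryTheory CategoryTheory.Limits

universe v u

namespace SemiAb

/-! ### Points over an object -/

/-- A point over `A`: a split epimorphism `p : pt ⟶ A` with a chosen section `s`. -/
structure Point {C : Type u} [Category.{v} C] (A : C) where
  pt : C
  p : pt ⟶ A
  s : A ⟶ pt
  s_p : s ≫ p = 𝟙 A

attribute [simp] Point.s_p

/-- A morphism of points over `A`: it commutes with the projections and with the sections. -/
@[ext]
structure Point.Hom {C : Type u} [Category.{v} C] {A : C} (X Y : Point A) where
  f : X.pt ⟶ Y.pt
  w_p : f ≫ Y.p = X.p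
  w_s : X.s ≫ f = Y.s

attribute [simp] Point.Hom.w_p Point.Hom.w_s

/-- The fibre `Pt_A(C)` of the fibration of points. -/
instance Point.instCategory {C : Type u} [Category.{v} C] (A : C) : Category (Point A) where
  Hom X Y := Point.Hom X Y
  id X := ⟨𝟙 X.pt, by simp, by simp⟩
  comp {X Y Z} f g := ⟨f.f ≫ g.f, by simp, by rw [← Category.assoc, f.w_s, g.w_s]⟩
  id_comp _ := Point.Hom.ext (Category.id_comp _)
  comp_id _ := Point.Hom.ext (Category.comp_id _)
  assoc _ _ _ := Point.Hom.ext (Category.assoc _ _ _)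

@[simp]
theorem Point.id_f {C : Type u} [Category.{v} C] {A : C} (X : Point A) :
    Point.Hom.f (𝟙 X) = 𝟙 X.pt := rfl

@[simp]
theorem Point.comp_f {C : Type u} [Category.{v} C] {A : C} {X Y Z : Point A} (f : X ⟶ Y)
    (g : Y ⟶ Z) : Point.Hom.f (f ≫ g) = Point.Hom.f f ≫ Point.Hom.f g := rfl

/-- `Pt_A(C)` is pointed by `(A, 𝟙, 𝟙)`; the zero morphism from `X` to `Y` goes through `A`. -/
instance Point.instHasZeroMorphisms {C : Type u} [Category.{v} C] (A : C) :
    HasZeroMorphisms (Point A) where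
  zero X Y := ⟨⟨X.p ≫ Y.s, by simp, by rw [← Category.assoc, X.s_p, Category.id_comp]⟩⟩
  comp_zero {X Y} f Z := Point.Hom.ext (by
    change f.f ≫ Y.p ≫ Z.s = X.p ≫ Z.s
    rw [← Category.assoc, f.w_p])
  zero_comp X {Y Z} f := Point.Hom.ext (by
    change (X.p ≫ Y.s) ≫ f.f = X.p ≫ Z.s
    rw [Category.assoc, f.w_s])

/-- The kernel functor `Pt_A(C) ⥤ C`, sending a point to the kernel of its projection. -/
@[simps]
noncomputable def kernelFunctor {C : Type u} [Category.{v} C] [HasZeroMorphisms C]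
    [HasFiniteLimits C] (A : C) : Point A ⥤ C where
  obj X := kernel X.p
  map {X Y} f := kernel.lift Y.p (kernel.ι X.p ≫ f.f) (by
    rw [Category.assoc, f.w_p, kernel.condition])
  map_id X := by
    ext
    simp
  map_comp f g := by
    ext
    simp

/-! ### Semi-abelian and strongly semi-abelian categories -/

/-- Normal monomorphisms of a pointed category: `f : X ⟶ Y` is normal when it is the zero class
of an internal equivalence relation `(r₁, r₂) : R ⇉ Y`, that is, when there is `n : X ⟶ R` with
`n ≫ r₁ = f` and `n ≫ r₂ = 0` which is universal among the morphisms into `R` killed by `r₂`.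
(Equivalently, `f` and `n` form the pullback of `⟨r₁, r₂⟩` along `⟨1, 0⟩`; such an `f` is
automatically monic, because `r₁` and `r₂` are jointly monic.) -/
def IsNormalMono {D : Type u} [Category.{v} D] [HasZeroMorphisms D] {X Y : D} (f : X ⟶ Y) :
    Prop :=
  ∃ (R : D) (r₁ r₂ : R ⟶ Y), IsEquivalenceRelation r₁ r₂ ∧
    ∃ (n : X ⟶ R) (w : n ≫ r₂ = 0), n ≫ r₁ = f ∧ Nonempty (IsLimit (KernelFork.ofι n w))

/-- A semi-abelian category: pointed, Barr exact (that is, regular with every internal equivalence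
relation a kernel pair), protomodular (that is, every kernel functor reflects isomorphisms), and
with finite coproducts. -/
class SemiAbelian (C : Type u) [Category.{v} C] [HasZeroMorphisms C] : Prop
    extends Regular C where
  hasZeroObject : HasZeroObject C
  hasFiniteCoproducts : HasFiniteCoproducts C
  effective {R X : C} (r₁ r₂ : R ⟶ X) : IsEquivalenceRelation r₁ r₂ →
    ∃ (Y : C) (f : X ⟶ Y), IsKernelPair f r₁ r₂
  protomodular (A : C) : (kernelFunctor A).ReflectsIsomorphisms

attribute [instance] SemiAbelian.hasZeroObject SemiAbelian.hasFiniteCoproducts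

/-- A normal functor between pointed categories: left exact, conservative, and reflecting normal
monomorphisms. -/
structure IsNormalFunctor {C : Type*} [Category* C] [HasZeroMorphisms C] {D : Type*}
    [Category* D] [HasZeroMorphisms D] (F : C ⥤ D) : Prop where
  leftExact : PreservesFiniteLimits F
  conservative : F.ReflectsIsomorphisms
  reflects_normalMono {X Y : C} (f : X ⟶ Y) : IsNormalMono (F.map f) → IsNormalMono f

/-- A strongly semi-abelian category: a semi-abelian category which is strongly protomodular, that
is, all of whose kernel functors are normal. -/
class StronglySemiAbelian (C : Type u) [Category.{v} C] [HasZeroMorphisms C] : Prop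
    extends SemiAbelian C where
  normal (A : C) : IsNormalFunctor (kernelFunctor A)

/-- A short exact sequence: `q` is a regular epimorphism and `k` is a kernel of `q`. -/
structure IsShortExact {C : Type u} [Category.{v} C] [HasZeroMorphisms C] {K A Q : C}
    (k : K ⟶ A) (q : A ⟶ Q) : Prop where
  zero : k ≫ q = 0
  isKernel : Nonempty (IsLimit (KernelFork.ofι k zero))
  regularEpi : IsRegularEpi q

/-! ### Internal actions -/

theorem map_comp_desc {C : Type u} [Category.{v} C] [HasZeroMorphisms C]
    [HasFiniteCoproducts C] {A B X Y : C}
    (a : A ⟶ B) (f : X ⟶ Y) :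
    coprod.map a f ≫ coprod.desc (𝟙 B) (0 : Y ⟶ B) =
      coprod.desc (𝟙 A) (0 : X ⟶ A) ≫ a := by
  ext <;> simp

section Actions

variable {C : Type u} [Category.{v} C] [HasZeroMorphisms C] [HasFiniteLimits C]
  [HasFiniteCoproducts C]

/-- The functor `C ⥤ Pt_A(C)` sending `X` to `[1, 0] : A ⨿ X ⟶ A` with section the first
injection. -/
noncomputable def sumFunctor (A : C) : C ⥤ Point A where
  obj X := ⟨A ⨿ X, coprod.desc (𝟙 A) 0, coprod.inl, coprod.inl_desc _ _⟩
  map {X Y} f := ⟨coprod.map (𝟙 A) f, (map_comp_desc _ _).trans (Category.comp_id _),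
    (coprod.inl_map _ _).trans (Category.id_comp _)⟩
  map_id X := Point.Hom.ext (by
    change coprod.map (𝟙 A) (𝟙 X) = 𝟙 (A ⨿ X)
    simp)
  map_comp {X Y Z} f g := Point.Hom.ext (by
    change coprod.map (𝟙 A) (f ≫ g) = coprod.map (𝟙 A) f ≫ coprod.map (𝟙 A) g
    simp)

theorem desc_counit {A : C} (X : Point A) :
    (kernel.ι (coprod.desc (𝟙 A) (0 : kernel X.p ⟶ A)) ≫
      coprod.desc X.s (kernel.ι X.p)) ≫ X.p = 0 := by
  have h : coprod.desc X.s (kernel.ι X.p) ≫ X.p = coprod.desc (𝟙 A) 0 := by ext <;> simp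
  rw [Category.assoc, h, kernel.condition]

/-- The functor `X ↦ (A ⨿ X ⇄ A)` is left adjoint to the kernel functor: the unit is induced by
the second injection `X ⟶ A ⨿ X`, the counit is `[s, ker p] : A ⨿ ker p ⟶ pt`. -/
noncomputable def sumKernelAdj (A : C) : sumFunctor A ⊣ kernelFunctor A :=
  Adjunction.mkOfUnitCounit
    { unit :=
        { app := fun X => kernel.lift (coprod.desc (𝟙 A) (0 : X ⟶ A)) coprod.inr
            (coprod.inr_desc _ _)
          naturality := fun X Y f => by
            apply (cancel_mono (kernel.ι (coprod.desc (𝟙 A) (0 : Y ⟶ A)))).1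
            change (f ≫ kernel.lift (coprod.desc (𝟙 A) (0 : Y ⟶ A)) coprod.inr _) ≫ _ =
              (kernel.lift (coprod.desc (𝟙 A) (0 : X ⟶ A)) coprod.inr _ ≫
                kernel.lift (coprod.desc (𝟙 A) (0 : Y ⟶ A))
                  (kernel.ι (coprod.desc (𝟙 A) (0 : X ⟶ A)) ≫ coprod.map (𝟙 A) f)
                  (by rw [Category.assoc, map_comp_desc, kernel.condition_assoc, zero_comp])) ≫ _
            rw [Category.assoc, Category.assoc, kernel.lift_ι, kernel.lift_ι,
              kernel.lift_ι_assoc, coprod.inr_map] }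
      counit :=
        { app := fun X =>
            ⟨coprod.desc X.s (kernel.ι X.p), by
              change coprod.desc X.s (kernel.ι X.p) ≫ X.p = coprod.desc (𝟙 A) 0
              ext <;> simp, coprod.inl_desc _ _⟩
          naturality := fun X Y f => Point.Hom.ext (by
            change coprod.map (𝟙 A) (kernel.lift Y.p (kernel.ι X.p ≫ f.f) _) ≫
              coprod.desc Y.s (kernel.ι Y.p) = coprod.desc X.s (kernel.ι X.p) ≫ f.f
            ext <;> simp) }
      left_triangle := by
        ext X
        apply Point.Hom.ext
        change coprod.map (𝟙 A) (kernel.lift (coprod.desc (𝟙 A) (0 : X ⟶ A)) coprod.inr _) ≫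
          𝟙 (A ⨿ _) ≫ coprod.desc coprod.inl (kernel.ι (coprod.desc (𝟙 A) (0 : X ⟶ A))) =
          𝟙 (A ⨿ X)
        ext <;> simp
      right_triangle := by
        ext X
        apply (cancel_mono (kernel.ι X.p)).1
        change (kernel.lift (coprod.desc (𝟙 A) (0 : kernel X.p ⟶ A)) coprod.inr _ ≫
          𝟙 (kernel (coprod.desc (𝟙 A) (0 : kernel X.p ⟶ A))) ≫ kernel.lift X.p
            (kernel.ι (coprod.desc (𝟙 A) (0 : kernel X.p ⟶ A)) ≫
              coprod.desc X.s (kernel.ι X.p)) (desc_counit X)) ≫ kernel.ι X.p = 𝟙 (kernel X.p) ≫ kernel.ι X.p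
        rw [Category.id_comp, Category.id_comp, Category.assoc, kernel.lift_ι]
        exact (kernel.lift_ι_assoc _ _ _ _).trans (coprod.inr_desc _ _) }

/-- The monad `A ♭ (-)` on `C` induced by the adjunction between `X ↦ (A ⨿ X ⇄ A)` and the
kernel functor. -/
noncomputable def flatMonad (A : C) : Monad C := (sumKernelAdj A).toMonad

/-- The object `A ♭ X`, that is, the kernel of `[1, 0] : A ⨿ X ⟶ A`. -/
noncomputable abbrev flat (A X : C) : C := (flatMonad A : C ⥤ C).obj X

/-- The kernel inclusion `κ : A ♭ X ⟶ A ⨿ X`. -/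
noncomputable def flatι (A X : C) : flat A X ⟶ A ⨿ X :=
  kernel.ι (coprod.desc (𝟙 A) (0 : X ⟶ A))

/-- The morphism `a ♭ f : A ♭ X ⟶ B ♭ Y` induced on kernels by `a ⨿ f : A ⨿ X ⟶ B ⨿ Y`. -/
noncomputable def flatMap {A B X Y : C} (a : A ⟶ B) (f : X ⟶ Y) : flat A X ⟶ flat B Y :=
  kernel.map (coprod.desc (𝟙 A) (0 : X ⟶ A)) (coprod.desc (𝟙 B) (0 : Y ⟶ B))
    (coprod.map a f) a (map_comp_desc a f).symm

/-- An internal `A`-action on `Y`: an algebra structure on `Y` for the monad `A ♭ (-)`. -/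
structure InternalAction (A Y : C) where
  act : flat A Y ⟶ Y
  unit : (flatMonad A).η.app Y ≫ act = 𝟙 Y
  assoc : (flatMonad A).μ.app Y ≫ act = (flatMonad A : C ⥤ C).map act ≫ act

/-- The trivial action `A ♭ Y ⟶ A ⨿ Y ⟶ Y`, the second morphism being `[0, 1]`. -/
noncomputable def trivialAction (A Y : C) : flat A Y ⟶ Y :=
  flatι A Y ≫ coprod.desc (0 : A ⟶ Y) (𝟙 Y)

end Actions

end SemiAb

namespace SemiAb

/-! Every action of `A` on `Y` is the action of a point over `A` on its kernel `Y`
(`InternalAction.exists_point`), and every point acts on its kernel (`Point.exists_action`). So the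
theorem is about descending a point along `q`.

If `ξ` comes from `Q`, its restriction to `K` factors through `0 ♭ 1`, which is the trivial action
followed by the unit of the monad.

Conversely, let `X` be a point over `A` inducing `ξ`, with projection `p` and section `s`.
Triviality over `K` gives a retraction `h : X ×_A K ⟶ Y` killing the section, so that `X ×_A K` is a
product. Now `X ×_A K` is also the kernel of the point `X ×_Q A` over `A`. The kernel pair `A ×_Q A`
is a subpoint of `X ×_Q A` by `(a', a) ↦ (s a', a)`, and on kernels this is the kernel of `h`. By
strong protomodularity it is normal, and the quotient point has kernel `Y`
(`Point.exists_quotient`). By protomodularity `X` is isomorphic to this quotient, which yields `g :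
X ×_Q A ⟶ X`, transporting `x` to the fibre over `a` (`exists_descent`). This `g` is a descent
datum: `x ~ g (x, a)` is an equivalence relation on `X`, whose quotient is a point over `Q` with
kernel `Y` (`exists_point_of_descent`). The action of that point restricts along `q` to `ξ`.

Strong protomodularity enters only through `Point.exists_quotient`, which also serves to build the
point of an action as a quotient of `A ⨿ Y`. -/

/-- `y` is a kernel of `p`, phrased by factorization of morphisms. -/
structure IsKernelOf {C : Type u} [Category.{v} C] [HasZeroMorphisms C] {Y X A : C}
    (y : Y ⟶ X) (p : X ⟶ A) : Prop where
  zero : y ≫ p = 0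
  mono : Mono y
  exists_lift {T : C} (t : T ⟶ X) : t ≫ p = 0 → ∃ l : T ⟶ Y, l ≫ y = t

/-! ### Kernels and normal monomorphisms. -/

section Basic

variable {C : Type u} [Category.{v} C] [HasZeroMorphisms C]

theorem isKernelOf_kernel_ι {X A : C} (p : X ⟶ A) [HasKernel p] :
    IsKernelOf (kernel.ι p) p :=
  ⟨kernel.condition p, inferInstance, fun t ht => ⟨kernel.lift p t ht, kernel.lift_ι _ _ _⟩⟩

theorem isKernelOf_of_isLimit {Y X A : C} {y : Y ⟶ X} {p : X ⟶ A} (w : y ≫ p = 0)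
    (h : IsLimit (KernelFork.ofι y w)) : IsKernelOf y p :=
  ⟨w, Fork.IsLimit.mono h, fun t ht => ⟨_, (KernelFork.IsLimit.lift' h t ht).2⟩⟩

theorem IsKernelOf.nonempty_isLimit {Y X A : C} {y : Y ⟶ X} {p : X ⟶ A} (h : IsKernelOf y p) :
    Nonempty (IsLimit (KernelFork.ofι y h.zero)) :=
  have := h.mono
  ⟨KernelFork.IsLimit.ofι' y h.zero fun t ht =>
    ⟨(h.exists_lift t ht).choose, (h.exists_lift t ht).choose_spec⟩⟩

/-- The kernel of a morphism is a normal monomorphism. -/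
theorem IsKernelOf.isNormalMono [HasFiniteLimits C] {Y X A : C} {y : Y ⟶ X} {p : X ⟶ A}
    (h : IsKernelOf y p) : IsNormalMono y := by
  have := h.mono
  have hk : IsKernelPair p (pullback.fst p p) (pullback.snd p p) := .of_hasPullback p
  -- The relation is the kernel pair of `p`; its zero class is included by `(y, 0)`.
  refine ⟨pullback p p, pullback.fst p p, pullback.snd p p,
    (hk.equivalenceRelation p _ _ (limit.isLimit _)).isEquivalenceRelation,
    pullback.lift y 0 (by rw [h.zero, zero_comp]), pullback.lift_snd _ _ _,
    pullback.lift_fst _ _ _, ?_⟩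
  refine IsKernelOf.nonempty_isLimit (p := pullback.snd p p) ⟨pullback.lift_snd _ _ _,
    ⟨fun a b hab => ?_⟩, fun t ht => ?_⟩
  · rw [← cancel_mono y]
    simpa [pullback.lift_fst] using hab =≫ pullback.fst p p
  · obtain ⟨l, hl⟩ := h.exists_lift (t ≫ pullback.fst p p) (by
      rw [Category.assoc, pullback.condition, reassoc_of% ht, zero_comp])
    exact ⟨l, by ext <;> simp [pullback.lift_fst, pullback.lift_snd, hl, ht]⟩

end Basic

/-! ### Consequences of protomodularity and exactness. -/

section Protomodular

variable {C : Type u} [Category.{v} C] [HasZeroMorphisms C] [SemiAbelian C]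

/-- A morphism of points that restricts to an isomorphism between kernels is an isomorphism. -/
theorem Point.Hom.isIso_of_isKernelOf {A Y : C} {X X' : Point A} (f : X ⟶ X')
    {x : Y ⟶ X.pt} (hx : IsKernelOf x X.p) (hx' : IsKernelOf (x ≫ Point.Hom.f f) X'.p) :
    IsIso (Point.Hom.f f) := by
  have := SemiAbelian.protomodular A
  have := hx.mono
  have := hx'.mono
  obtain ⟨l, hl⟩ := hx.exists_lift (kernel.ι X.p) (kernel.condition _)
  obtain ⟨l', hl'⟩ := hx'.exists_lift (kernel.ι X'.p) (kernel.condition _)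
  let κ : kernel X.p ⟶ kernel X'.p := kernel.lift X'.p (kernel.ι X.p ≫ Point.Hom.f f) (by
    rw [Category.assoc, f.w_p, kernel.condition])
  have hκ : κ ≫ kernel.ι X'.p = kernel.ι X.p ≫ Point.Hom.f f := kernel.lift_ι _ _ _
  have hκl : κ ≫ l' = l := by
    rw [← cancel_mono (x ≫ Point.Hom.f f), Category.assoc, hl', hκ, reassoc_of% hl]
  have hi : IsIso κ := by
    refine ⟨l' ≫ kernel.lift X.p x hx.zero, ?_, ?_⟩
    · rw [reassoc_of% hκl, ← cancel_mono (kernel.ι X.p), Category.assoc, kernel.lift_ι, hl,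
        Category.id_comp]
    · rw [← cancel_mono (kernel.ι X'.p), Category.assoc, Category.assoc, hκ,
        kernel.lift_ι_assoc, hl', Category.id_comp]
  have : IsIso ((kernelFunctor A).map f) := hi
  have : IsIso f := isIso_of_reflects_iso f (kernelFunctor A)
  exact ⟨Point.Hom.f (inv f), by rw [← Point.comp_f, IsIso.hom_inv_id, Point.id_f],
    by rw [← Point.comp_f, IsIso.inv_hom_id, Point.id_f]⟩

/-- A subobject of a point that contains the section and the kernel is everything. -/
theorem Point.isIso_of_mono {A Y M : C} (X : Point A) {x : Y ⟶ X.pt} (hx : IsKernelOf x X.p)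
    (m : M ⟶ X.pt) [Mono m] (s : A ⟶ M) (hs : s ≫ m = X.s) (y : Y ⟶ M) (hy : y ≫ m = x) :
    IsIso m := by
  -- Containing the section makes `M` a point; its kernel is `y`, so `m` is the identity of `Y` on
  -- kernels.
  let X' : Point A := ⟨M, m ≫ X.p, s, by rw [reassoc_of% hs, X.s_p]⟩
  let f : X' ⟶ X := ⟨m, rfl, hs⟩
  have := hx.mono
  refine Point.Hom.isIso_of_isKernelOf f (x := y) ⟨?_, ?_, fun t ht => ?_⟩ ?_
  · change y ≫ m ≫ X.p = 0
    rw [reassoc_of% hy, hx.zero]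
  · have : Mono (y ≫ m) := by rwa [hy]
    exact mono_of_mono y m
  · obtain ⟨l, hl⟩ := hx.exists_lift (t ≫ m) (by simpa [X'] using ht)
    exact ⟨l, by rw [← cancel_mono m, Category.assoc, hy, hl]⟩
  · change IsKernelOf (y ≫ m) X.p
    rwa [hy]

/-- The section and the kernel of a point are jointly epic. -/
theorem Point.hom_ext {A Y T : C} (X : Point A) {x : Y ⟶ X.pt} (hx : IsKernelOf x X.p)
    {f g : X.pt ⟶ T} (hs : X.s ≫ f = X.s ≫ g) (hk : x ≫ f = x ≫ g) : f = g := by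
  have := X.isIso_of_mono hx (equalizer.ι f g) (equalizer.lift X.s hs) (by simp)
    (equalizer.lift x hk) (by simp)
  rw [← cancel_epi (equalizer.ι f g), equalizer.condition]

/-- The pullback of `f` along `φ`, as a point over the source of `φ`, the section being induced by
a factorization of `φ` through `f`. -/
noncomputable abbrev pullbackPoint {X B G : C} (f : X ⟶ B) (φ : G ⟶ B) (σ : G ⟶ X)
    (hσ : σ ≫ f = φ) : Point G :=
  ⟨pullback f φ, pullback.snd f φ, pullback.lift σ (𝟙 G) (by rw [hσ, Category.id_comp]),
    pullback.lift_snd _ _ _⟩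

theorem isKernelOf_pullback_snd {L X B G : C} {f : X ⟶ B} (φ : G ⟶ B) {l : L ⟶ X}
    (hl : IsKernelOf l f) :
    IsKernelOf (pullback.lift l 0 (by rw [hl.zero, zero_comp]) : L ⟶ pullback f φ)
      (pullback.snd f φ) := by
  have := hl.mono
  refine ⟨pullback.lift_snd _ _ _, ⟨fun a b hab => ?_⟩, fun t ht => ?_⟩
  · rw [← cancel_mono l]
    simpa [pullback.lift_fst] using hab =≫ pullback.fst f φ
  · obtain ⟨j, hj⟩ := hl.exists_lift (t ≫ pullback.fst f φ) (by
      rw [Category.assoc, pullback.condition, reassoc_of% ht, zero_comp])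
    exact ⟨j, by ext <;> simp [pullback.lift_fst, pullback.lift_snd, hj, ht]⟩

/-- A regular epimorphism is a cokernel of its kernel. -/
theorem exists_desc_of_kernel {X W T : C} (f : X ⟶ W) [IsRegularEpi f] (t : X ⟶ T)
    (h : ∀ {N : C} (n : N ⟶ X), n ≫ f = 0 → n ≫ t = 0) : ∃ d : W ⟶ T, f ≫ d = t := by
  -- It suffices that `t` coequalizes the kernel pair of `f`. That is a point over `X`, split by the
  -- diagonal, so only the diagonal and the kernel `(ker f, 0)` need checking.
  refine IsRegularEpi.exists_of_isKernelPair f (IsKernelPair.of_hasPullback f) t ?_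
  refine (pullbackPoint f f (𝟙 X) (Category.id_comp f)).hom_ext
    (isKernelOf_pullback_snd f (isKernelOf_kernel_ι f)) ?_ ?_
  · simp [pullback.lift_fst_assoc, pullback.lift_snd_assoc]
  · simp [pullback.lift_fst_assoc, pullback.lift_snd_assoc, h _ (kernel.condition f)]

/-- A morphism with trivial kernel is a monomorphism. -/
theorem mono_of_kernel {X T : C} (f : X ⟶ T)
    (h : ∀ {N : C} (n : N ⟶ X), n ≫ f = 0 → n = 0) : Mono f := by
  refine (IsKernelPair.of_hasPullback f).mono_of_eq_fst_snd ?_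
  refine (pullbackPoint f f (𝟙 X) (Category.id_comp f)).hom_ext
    (isKernelOf_pullback_snd f (isKernelOf_kernel_ι f)) ?_ ?_
  · simp [pullback.lift_fst, pullback.lift_snd]
  · simp [pullback.lift_fst, pullback.lift_snd, h _ (kernel.condition f)]

/-- Every morphism factors as a regular epimorphism followed by a monomorphism. -/
theorem exists_image_factorisation {X T : C} (f : X ⟶ T) :
    ∃ (I : C) (e : X ⟶ I) (m : I ⟶ T), IsRegularEpi e ∧ Mono m ∧ e ≫ m = f :=
  ⟨_, (Regular.strongEpiMonoFactorisation f).e, (Regular.strongEpiMonoFactorisation f).m,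
    inferInstance, inferInstance, (Regular.strongEpiMonoFactorisation f).fac⟩

/-- Recognition of the kernel of `p` from a kernel of its restriction along a regular
epimorphism. -/
theorem IsKernelOf.of_regularEpi {B W A L Y : C} (π : B ⟶ W) [IsRegularEpi π] {p : W ⟶ A}
    {y : Y ⟶ W} [Mono y] (hy : y ≫ p = 0) {l : L ⟶ B} (hl : IsKernelOf l (π ≫ p))
    (g : L ⟶ Y) (hg : g ≫ y = l ≫ π) : IsKernelOf y p := by
  refine ⟨hy, inferInstance, fun t ht => ?_⟩
  let y' : Y ⟶ kernel p := kernel.lift p y hy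
  -- The regular epimorphism `r`, a pullback of `π`, factors through the comparison `y'`, which is
  -- therefore both strong epic and monic.
  let r : pullback π (kernel.ι p) ⟶ kernel p := pullback.snd π (kernel.ι p)
  obtain ⟨j, hj⟩ := hl.exists_lift (pullback.fst π (kernel.ι p)) (by
    rw [pullback.condition_assoc, kernel.condition, comp_zero])
  have hr : (j ≫ g) ≫ y' = r := by
    rw [← cancel_mono (kernel.ι p), Category.assoc, Category.assoc, kernel.lift_ι, hg,
      reassoc_of% hj, pullback.condition]
  have : StrongEpi ((j ≫ g) ≫ y') := by rw [hr]; infer_instance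
  have : StrongEpi y' := strongEpi_of_strongEpi (j ≫ g) y'
  have : Mono y' := by
    have : Mono (y' ≫ kernel.ι p) := by rwa [kernel.lift_ι]
    exact mono_of_mono y' (kernel.ι p)
  have : IsIso y' := isIso_of_mono_of_strongEpi y'
  refine ⟨kernel.lift p t ht ≫ inv y', ?_⟩
  have : inv y' ≫ y = kernel.ι p := by rw [IsIso.inv_comp_eq, kernel.lift_ι]
  rw [Category.assoc, this, kernel.lift_ι]

/-- An internal equivalence relation is the kernel pair of a regular epimorphism. -/
theorem exists_quotient {R X : C} (r₁ r₂ : R ⟶ X) (h : IsEquivalenceRelation r₁ r₂) :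
    ∃ (Z : C) (π : X ⟶ Z), IsRegularEpi π ∧ IsKernelPair π r₁ r₂ := by
  obtain ⟨Y, f, hf⟩ := SemiAbelian.effective r₁ r₂ h
  have := Regular.hasCoequalizer_of_isKernelPair hf
  refine ⟨coequalizer r₁ r₂, coequalizer.π r₁ r₂, inferInstance,
    IsKernelPair.cancel_right (f₂ := coequalizer.desc f hf.w) (coequalizer.condition r₁ r₂) ?_⟩
  rwa [coequalizer.π_desc]

end Protomodular

/-! ### Free points, used to compare limits of points with limits in the base. -/

section FreePoint

variable {C : Type u} [Category.{v} C] [HasFiniteCoproducts C]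

/-- The free point on an object over `A`. -/
noncomputable def freePoint {A T : C} (t : T ⟶ A) : Point A :=
  ⟨A ⨿ T, coprod.desc (𝟙 A) t, coprod.inl, coprod.inl_desc _ _⟩

/-- The canonical morphism to the free point. -/
noncomputable def freePointι {A T : C} (t : T ⟶ A) : T ⟶ (freePoint t).pt :=
  coprod.inr

/-- The morphism of points induced by a morphism over `A`. -/
noncomputable def freePointDesc {A T : C} {t : T ⟶ A} {X : Point A} (f : T ⟶ X.pt)
    (hf : f ≫ X.p = t) : freePoint t ⟶ X where
  f := coprod.desc X.s f
  w_p := by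
    change coprod.desc X.s f ≫ X.p = coprod.desc (𝟙 A) t
    ext <;> simp [hf]
  w_s := coprod.inl_desc _ _

theorem freePointι_p {A T : C} (t : T ⟶ A) : freePointι t ≫ (freePoint t).p = t :=
  coprod.inr_desc _ _

theorem freePointι_desc {A T : C} {t : T ⟶ A} {X : Point A} (f : T ⟶ X.pt)
    (hf : f ≫ X.p = t) : freePointι t ≫ Point.Hom.f (freePointDesc f hf) = f :=
  coprod.inr_desc _ _

theorem freePoint_hom_ext {A T : C} {t : T ⟶ A} {X : Point A} {f g : freePoint t ⟶ X}
    (h : freePointι t ≫ Point.Hom.f f = freePointι t ≫ Point.Hom.f g) : f = g :=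
  Point.Hom.ext (coprod.hom_ext (f.w_s.trans g.w_s.symm) h)

theorem freePointι_desc_comp {A T : C} {t : T ⟶ A} {X X' : Point A} (f : T ⟶ X.pt)
    (hf : f ≫ X.p = t) (g : X ⟶ X') :
    freePointι t ≫ Point.Hom.f (freePointDesc f hf ≫ g) = f ≫ Point.Hom.f g := by
  rw [Point.comp_f, ← Category.assoc, freePointι_desc]

/-- Kernels in the category of points, tested on morphisms of the base category. -/
theorem Point.exists_lift_of_isLimit {A T : C} {N R X : Point A} {n : N ⟶ R} {r : R ⟶ X}
    {w : n ≫ r = 0} (h : IsLimit (KernelFork.ofι n w)) (t : T ⟶ R.pt)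
    (ht : t ≫ Point.Hom.f r = t ≫ R.p ≫ X.s) : ∃ l : T ⟶ N.pt, l ≫ Point.Hom.f n = t := by
  -- A morphism of the base over `A` becomes a morphism of points once extended to the free point on
  -- its source.
  have hz : (freePointDesc t rfl : freePoint (t ≫ R.p) ⟶ R) ≫ r = 0 := by
    apply freePoint_hom_ext
    rw [freePointι_desc_comp, ht]
    change _ = freePointι (t ≫ R.p) ≫ (freePoint (t ≫ R.p)).p ≫ X.s
    rw [← Category.assoc (freePointι _), freePointι_p, Category.assoc]
  obtain ⟨l, hl⟩ := KernelFork.IsLimit.lift' h _ hz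
  refine ⟨freePointι _ ≫ Point.Hom.f l, ?_⟩
  rw [Category.assoc, ← Point.comp_f]
  exact (freePointι _ ≫= congrArg Point.Hom.f hl).trans (freePointι_desc _ _)

variable [HasFiniteLimits C]

/-- The forgetful functor from points preserves internal equivalence relations. -/
theorem Point.isEquivalenceRelation_forget {A : C} {R X : Point A} {r₁ r₂ : R ⟶ X}
    (h : IsEquivalenceRelation r₁ r₂) :
    IsEquivalenceRelation (Point.Hom.f r₁) (Point.Hom.f r₂) := by
  obtain ⟨e⟩ := h.nonempty_equivalenceRelation
  -- Composable pairs have both components over the same element of `A`, so the transitivity of `e`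
  -- can be evaluated on a free point.
  have hp {T : C} {a b : T ⟶ R.pt} (hab : a ≫ Point.Hom.f r₂ = b ≫ Point.Hom.f r₁) :
      a ≫ R.p = b ≫ R.p := by
    rw [← r₂.w_p, ← Category.assoc, hab, Category.assoc, r₁.w_p, r₂.w_p]
  let P := pullback (Point.Hom.f r₂) (Point.Hom.f r₁)
  let a : P ⟶ R.pt := pullback.fst _ _
  let b : P ⟶ R.pt := pullback.snd _ _
  let a' : freePoint (a ≫ R.p) ⟶ R := freePointDesc a rfl
  let b' : freePoint (a ≫ R.p) ⟶ R := freePointDesc b (hp pullback.condition).symm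
  have hab : a' ≫ r₂ = b' ≫ r₁ := by
    apply freePoint_hom_ext
    rw [freePointι_desc_comp, freePointι_desc_comp]
    exact pullback.condition
  let c : freePoint (a ≫ R.p) ⟶ e.c.pt := PullbackCone.IsLimit.lift e.isLimit a' b' hab
  refine EquivalenceRelation.isEquivalenceRelation
    { right_cancellation := fun T f g h₁ h₂ => ?_
      r := Point.Hom.f e.r
      reflexivity₁ := congrArg Point.Hom.f e.reflexivity₁
      reflexivity₂ := congrArg Point.Hom.f e.reflexivity₂
      s := Point.Hom.f e.s
      symmetry₁ := congrArg Point.Hom.f e.symmetry₁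
      symmetry₂ := congrArg Point.Hom.f e.symmetry₂
      c := _
      isLimit := limit.isLimit (cospan (Point.Hom.f r₂) (Point.Hom.f r₁))
      t := freePointι _ ≫ Point.Hom.f (c ≫ e.t)
      transitivity₁ := ?_
      transitivity₂ := ?_ }
  · have hfg : g ≫ R.p = f ≫ R.p := by rw [← r₁.w_p, reassoc_of% h₁]
    have := e.right_cancellation (freePointDesc f rfl) (freePointDesc g hfg)
      (freePoint_hom_ext (by
        rw [freePointι_desc_comp, freePointι_desc_comp, h₁]))
      (freePoint_hom_ext (by
        rw [freePointι_desc_comp, freePointι_desc_comp, h₂]))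
    rw [← freePointι_desc f rfl, this, freePointι_desc]
  · have : (c ≫ e.t) ≫ r₁ = a' ≫ r₁ := by
      rw [Category.assoc, e.transitivity₁, PullbackCone.IsLimit.lift_fst_assoc]
    rw [Category.assoc, ← Point.comp_f, this, freePointι_desc_comp]
    rfl
  · have : (c ≫ e.t) ≫ r₂ = b' ≫ r₂ := by
      rw [Category.assoc, e.transitivity₂, PullbackCone.IsLimit.lift_snd_assoc]
    rw [Category.assoc, ← Point.comp_f, this, freePointι_desc_comp]
    rfl

end FreePoint

/-! ### Quotients of points by strong protomodularity. -/

section Quotient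

variable {C : Type u} [Category.{v} C] [HasZeroMorphisms C] [StronglySemiAbelian C]

/-- Let `h` be a split epimorphism out of the kernel `b` of a point `B`. If some subpoint `m` of
`B` has the same kernel as `h`, then `h` is the restriction to kernels of a morphism of points. -/
theorem Point.exists_quotient {A L Y : C} {B M : Point A} {b : L ⟶ B.pt} (hb : IsKernelOf b B.p)
    (m : M ⟶ B) [Mono (Point.Hom.f m)] (h : L ⟶ Y) [IsSplitEpi h]
    (hm : ∀ {T : C} (l : T ⟶ M.pt) (t : T ⟶ L), l ≫ Point.Hom.f m = t ≫ b → t ≫ h = 0)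
    (hm' : ∀ {T : C} (t : T ⟶ L), t ≫ h = 0 → ∃ l : T ⟶ M.pt, l ≫ Point.Hom.f m = t ≫ b) :
    ∃ (W : Point A) (e : B ⟶ W) (y : Y ⟶ W.pt), IsKernelOf y W.p ∧
      b ≫ Point.Hom.f e = h ≫ y := by
  have := hb.mono
  -- On kernels `m` is the kernel of `j ≫ h`, hence normal there; the kernel functor reflects this.
  have hnormal : IsNormalMono m := by
    apply (StronglySemiAbelian.normal A).reflects_normalMono
    obtain ⟨j, hj⟩ := hb.exists_lift (kernel.ι B.p) (kernel.condition _)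
    let κ : kernel M.p ⟶ kernel B.p := kernel.lift B.p (kernel.ι M.p ≫ Point.Hom.f m) (by
      rw [Category.assoc, m.w_p, kernel.condition])
    have hκ : κ ≫ kernel.ι B.p = kernel.ι M.p ≫ Point.Hom.f m := kernel.lift_ι _ _ _
    refine IsKernelOf.isNormalMono (y := κ) (p := j ≫ h) ⟨?_, ⟨fun f g hfg => ?_⟩, fun t ht => ?_⟩
    · rw [← Category.assoc]
      exact hm (kernel.ι M.p) _ (by rw [Category.assoc, hj, hκ])
    · rw [← cancel_mono (kernel.ι M.p), ← cancel_mono (Point.Hom.f m), Category.assoc,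
        Category.assoc, ← hκ, reassoc_of% hfg]
    · obtain ⟨l, hl⟩ := hm' (t ≫ j) (by rw [Category.assoc, ht])
      rw [Category.assoc, hj] at hl
      refine ⟨kernel.lift M.p l (by rw [← m.w_p, reassoc_of% hl, kernel.condition, comp_zero]), ?_⟩
      rw [← cancel_mono (kernel.ι B.p), Category.assoc, hκ, kernel.lift_ι_assoc, hl]
  obtain ⟨R, r₁, r₂, hR, n, w, hn, ⟨hlim⟩⟩ := hnormal
  obtain ⟨Z, π, hπ, hk⟩ := SemiAb.exists_quotient _ _ (Point.isEquivalenceRelation_forget hR)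
  obtain ⟨p, hp⟩ := IsRegularEpi.exists_of_isKernelPair π hk B.p (r₁.w_p.trans r₂.w_p.symm)
  let W : Point A := ⟨Z, p, B.s ≫ π, by rw [Category.assoc, hp, B.s_p]⟩
  have hnm : Point.Hom.f n ≫ Point.Hom.f r₁ = Point.Hom.f m := congrArg Point.Hom.f hn
  have hn0 : Point.Hom.f n ≫ Point.Hom.f r₂ = M.p ≫ B.s := congrArg Point.Hom.f w
  -- The kernel of `h` lies in `M`, the zero class of `R`, so `π` kills it.
  obtain ⟨y, hy⟩ := exists_desc_of_kernel h (b ≫ π) (fun t ht => by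
    obtain ⟨l, hl⟩ := hm' t ht
    have hl0 : l ≫ M.p = 0 := by rw [← m.w_p, reassoc_of% hl, hb.zero, comp_zero]
    rw [← Category.assoc, ← hl, ← hnm, Category.assoc, Category.assoc, hk.w, reassoc_of% hn0,
      reassoc_of% hl0, zero_comp])
  have hyπ : y = section_ h ≫ b ≫ π := by
    rw [← cancel_epi h, hy, ← hy, IsSplitEpi.id_assoc]
  -- If `y` kills `t`, then `(t ≫ section_ h ≫ b, 0)` lies in `R`, so its first component lies in
  -- `M` and `h` kills `t ≫ section_ h`.
  have : Mono y := mono_of_kernel y fun {N} t ht => by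
    rw [hyπ] at ht
    let v : N ⟶ R.pt := hk.lift (t ≫ section_ h ≫ b) 0 (by simpa using ht)
    have hv₁ : v ≫ Point.Hom.f r₁ = t ≫ section_ h ≫ b := hk.lift_fst _ _ _
    have hv₂ : v ≫ Point.Hom.f r₂ = 0 := hk.lift_snd _ _ _
    have hvp : v ≫ R.p = 0 := by rw [← r₂.w_p, reassoc_of% hv₂, zero_comp]
    obtain ⟨l, hl⟩ := Point.exists_lift_of_isLimit hlim v (by
      rw [hv₂, reassoc_of% hvp, zero_comp])
    have := hm l (t ≫ section_ h) (by
      rw [← hnm, reassoc_of% hl, hv₁, Category.assoc])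
    simpa using this
  refine ⟨W, ⟨π, hp, rfl⟩, y, ?_, hy.symm⟩
  refine IsKernelOf.of_regularEpi π (l := b) ?_ (by rwa [hp]) h hy
  rw [← cancel_epi h, reassoc_of% hy, hp, hb.zero, comp_zero]

end Quotient

/-! ### The monad `A ♭ (-)` and the action of a point on its kernel. -/

section Flat

variable {C : Type u} [Category.{v} C] [HasZeroMorphisms C] [HasFiniteLimits C]
  [HasFiniteCoproducts C]

theorem isKernelOf_flatι (A Y : C) :
    IsKernelOf (flatι A Y) (coprod.desc (𝟙 A) (0 : Y ⟶ A)) :=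
  isKernelOf_kernel_ι _

instance (A Y : C) : Mono (flatι A Y) := (isKernelOf_flatι A Y).mono

theorem flatι_desc (A Y : C) : flatι A Y ≫ coprod.desc (𝟙 A) (0 : Y ⟶ A) = 0 :=
  (isKernelOf_flatι A Y).zero

theorem flatMap_flatι {A B X Y : C} (a : A ⟶ B) (f : X ⟶ Y) :
    flatMap a f ≫ flatι B Y = flatι A X ≫ coprod.map a f :=
  kernel.lift_ι _ _ _

theorem flatMonad_map {A X Y : C} (f : X ⟶ Y) :
    (flatMonad A : C ⥤ C).map f = flatMap (𝟙 A) f := by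
  rw [← cancel_mono (flatι A Y), flatMap_flatι]
  exact kernel.lift_ι _ _ _

/-- The unit of the monad `A ♭ (-)`. -/
noncomputable def flatη (A Y : C) : Y ⟶ flat A Y :=
  (flatMonad A).η.app Y

theorem InternalAction.flatη_act {A Y : C} (ξ : InternalAction A Y) :
    flatη A Y ≫ ξ.act = 𝟙 Y :=
  ξ.unit

theorem flatη_flatι (A Y : C) : flatη A Y ≫ flatι A Y = coprod.inr :=
  kernel.lift_ι _ _ _

theorem flatMonad_μ_flatι (A Y : C) :
    (flatMonad A).μ.app Y ≫ flatι A Y =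
      flatι A (flat A Y) ≫ coprod.desc coprod.inl (flatι A Y) :=
  kernel.lift_ι _ _ _

/-- The action of a point on its kernel. -/
theorem Point.exists_action {A Y : C} (X : Point A) {y : Y ⟶ X.pt} (hy : IsKernelOf y X.p) :
    ∃ ξ : InternalAction A Y, ξ.act ≫ y = flatι A Y ≫ coprod.desc X.s y := by
  have := hy.mono
  have hp : coprod.desc X.s y ≫ X.p = coprod.desc (𝟙 A) 0 := by ext <;> simp [hy.zero]
  obtain ⟨ξ, hξ⟩ := hy.exists_lift (flatι A Y ≫ coprod.desc X.s y) (by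
    rw [Category.assoc, hp, flatι_desc])
  refine ⟨⟨ξ, ?_, ?_⟩, hξ⟩
  · change flatη A Y ≫ ξ = 𝟙 Y
    rw [← cancel_mono y, Category.assoc, hξ, reassoc_of% flatη_flatι, coprod.inr_desc,
      Category.id_comp]
  · rw [← cancel_mono y, Category.assoc, Category.assoc, hξ, flatMonad_map,
      reassoc_of% flatMonad_μ_flatι, reassoc_of% flatMap_flatι]
    congr 1
    ext <;> simp [hξ, coprod.inl_desc, coprod.inr_desc]

/-- `1 ⨿ 0` factors through `[1, 0]`, whose kernel is `A ♭ X`. -/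
theorem flatMonad_map_zero {A X Y : C} : (flatMonad A : C ⥤ C).map (0 : X ⟶ Y) = 0 := by
  have h : coprod.map (𝟙 A) (0 : X ⟶ Y) = coprod.desc (𝟙 A) (0 : X ⟶ A) ≫ coprod.inl := by
    ext <;> simp [coprod.inl_desc, coprod.inr_desc]
  rw [flatMonad_map, ← cancel_mono (flatι A Y), flatMap_flatι, h, reassoc_of% flatι_desc]
  simp

end Flat

/-! ### Semidirect products: from actions to points. -/

section SemiDirect

variable {C : Type u} [Category.{v} C] [HasZeroMorphisms C]

/-- A point is the semidirect product of its kernel: morphisms out of it are the equivariant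
pairs. -/
theorem Point.exists_desc [SemiAbelian C] {A Y T : C} (X : Point A) {y : Y ⟶ X.pt}
    (hy : IsKernelOf y X.p) {ξ : flat A Y ⟶ Y} (hξ : ξ ≫ y = flatι A Y ≫ coprod.desc X.s y)
    (f : A ⟶ T) (g : Y ⟶ T) (hfg : flatι A Y ≫ coprod.desc f g = ξ ≫ g) :
    ∃ d : X.pt ⟶ T, X.s ≫ d = f ∧ y ≫ d = g := by
  have := hy.mono
  -- The image of `[s, y]` contains the section and the kernel, so `[s, y]` is a regular
  -- epimorphism. Its kernel lies in `A ♭ Y` and is killed by `ξ`.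
  obtain ⟨I, e, m, he, hm, hem⟩ := exists_image_factorisation (coprod.desc X.s y)
  have : IsIso m := X.isIso_of_mono hy m (coprod.inl ≫ e)
    (by simp [hem, coprod.inl_desc]) (coprod.inr ≫ e)
    (by simp [hem, coprod.inr_desc])
  have : StrongEpi (coprod.desc X.s y) := by
    rw [← hem]
    infer_instance
  have : IsRegularEpi (coprod.desc X.s y) := inferInstance
  have hp : coprod.desc X.s y ≫ X.p = coprod.desc (𝟙 A) 0 := by ext <;> simp [hy.zero]
  obtain ⟨d, hd⟩ := exists_desc_of_kernel (coprod.desc X.s y) (coprod.desc f g)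
    (fun n hn => by
      obtain ⟨l, hl⟩ := (isKernelOf_flatι A Y).exists_lift n (by
        rw [← hp, reassoc_of% hn, zero_comp])
      have hlξ : l ≫ ξ = 0 := by
        rw [← cancel_mono y, Category.assoc, hξ, reassoc_of% hl, hn, zero_comp]
      rw [← hl, Category.assoc, hfg, reassoc_of% hlξ, zero_comp])
  exact ⟨d, by simpa [coprod.inl_desc, coprod.inl_desc_assoc] using coprod.inl ≫= hd,
    by simpa [coprod.inr_desc, coprod.inr_desc_assoc] using coprod.inr ≫= hd⟩

/-- Every action is the action of a point on its kernel. -/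
theorem InternalAction.exists_point [StronglySemiAbelian C] {A Y : C} (ξ : InternalAction A Y) :
    ∃ (X : Point A) (y : Y ⟶ X.pt), IsKernelOf y X.p ∧
      ξ.act ≫ y = flatι A Y ≫ coprod.desc X.s y := by
  let n : kernel ξ.act ⟶ flat A Y := kernel.ι ξ.act
  -- The subpoint of `A ⨿ Y` generated by the kernel of `ξ`. It meets `A ♭ Y` in nothing more than
  -- that kernel, by the associativity of the action.
  obtain ⟨I, e, m, he, hm, hem⟩ := exists_image_factorisation
    (coprod.desc coprod.inl (n ≫ flatι A Y))
  let B : Point A := ⟨A ⨿ Y, coprod.desc (𝟙 A) 0, coprod.inl, coprod.inl_desc _ _⟩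
  let M : Point A := ⟨I, m ≫ coprod.desc (𝟙 A) 0, coprod.inl ≫ e, by
    rw [Category.assoc, reassoc_of% hem]
    simp [coprod.inl_desc]⟩
  let m' : M ⟶ B := ⟨m, rfl, by
    change (coprod.inl ≫ e) ≫ m = coprod.inl
    simp [hem, coprod.inl_desc]⟩
  have : Mono (Point.Hom.f m') := hm
  have : IsSplitEpi ξ.act := ⟨⟨flatη A Y, ξ.flatη_act⟩⟩
  have hnμ : ((flatMonad A : C ⥤ C).map n ≫ (flatMonad A).μ.app Y) ≫ flatι A Y =
      flatι A (kernel ξ.act) ≫ coprod.desc coprod.inl (n ≫ flatι A Y) := by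
    rw [Category.assoc, flatMonad_μ_flatι, flatMonad_map, reassoc_of% flatMap_flatι]
    congr 1
    ext <;> simp [coprod.inl_desc, coprod.inr_desc]
  have hnξ : ((flatMonad A : C ⥤ C).map n ≫ (flatMonad A).μ.app Y) ≫ ξ.act = 0 := by
    rw [Category.assoc, ξ.assoc, ← Functor.map_comp_assoc, kernel.condition, flatMonad_map_zero,
      zero_comp]
  have hm₁ {T : C} (l : T ⟶ M.pt) (t : T ⟶ flat A Y)
      (hlt : l ≫ Point.Hom.f m' = t ≫ flatι A Y) : t ≫ ξ.act = 0 := by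
    change l ≫ m = t ≫ flatι A Y at hlt
    -- After the cover `q₂`, an element of `I` lying in `A ♭ Y` lifts to `A ♭ ker ξ`, where `hnξ`
    -- applies.
    let q₁ : pullback e l ⟶ A ⨿ kernel ξ.act := pullback.fst e l
    let q₂ : pullback e l ⟶ T := pullback.snd e l
    have hq : q₁ ≫ e = q₂ ≫ l := pullback.condition
    have hq' : q₁ ≫ coprod.desc coprod.inl (n ≫ flatι A Y) = q₂ ≫ t ≫ flatι A Y := by
      rw [← hem, reassoc_of% hq, hlt]
    have hd : coprod.desc coprod.inl (n ≫ flatι A Y) ≫ coprod.desc (𝟙 A) (0 : Y ⟶ A) =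
        coprod.desc (𝟙 A) 0 := by
      ext <;> simp [flatι_desc, coprod.inl_desc, coprod.inr_desc]
    obtain ⟨r, hr⟩ := (isKernelOf_flatι A _).exists_lift q₁ (by
      rw [← hd, reassoc_of% hq', flatι_desc, comp_zero, comp_zero])
    have ht : q₂ ≫ t = r ≫ (flatMonad A : C ⥤ C).map n ≫ (flatMonad A).μ.app Y := by
      rw [← cancel_mono (flatι A Y), Category.assoc, ← hq', ← hr, Category.assoc, ← hnμ]
      simp
    have : Epi q₂ := inferInstanceAs (Epi (pullback.snd e l))
    rw [← cancel_epi q₂, ← Category.assoc, ht, Category.assoc, hnξ]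
    simp
  have hm₂ {T : C} (t : T ⟶ flat A Y) (ht : t ≫ ξ.act = 0) :
      ∃ l : T ⟶ M.pt, l ≫ Point.Hom.f m' = t ≫ flatι A Y := by
    refine ⟨kernel.lift ξ.act t ht ≫ coprod.inr ≫ e, ?_⟩
    change (kernel.lift ξ.act t ht ≫ coprod.inr ≫ e) ≫ m = t ≫ flatι A Y
    rw [Category.assoc, Category.assoc, hem, coprod.inr_desc, kernel.lift_ι_assoc]
  obtain ⟨W, w, y, hy, h⟩ :=
    Point.exists_quotient (B := B) (isKernelOf_flatι A Y) m' ξ.act hm₁ hm₂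
  refine ⟨W, y, hy, ?_⟩
  have hw : Point.Hom.f w = coprod.desc W.s y := by
    apply coprod.hom_ext
    · rw [coprod.inl_desc]
      exact w.w_s
    · rw [coprod.inr_desc, ← flatη_flatι, Category.assoc]
      exact (flatη A Y ≫= h).trans ((reassoc_of% ξ.flatη_act) y)
  rw [← h, hw]

end SemiDirect

/-! ### Descent of a point along a regular epimorphism. -/

section Descent

variable {C : Type u} [Category.{v} C] [HasZeroMorphisms C]

/-- If `K` acts trivially on the kernel of `X`, then the restriction of `X` to `K` is a product. -/
theorem exists_retraction_of_trivial [SemiAbelian C] {K A Y : C} (k : K ⟶ A) (X : Point A)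
    {y : Y ⟶ X.pt} (hy : IsKernelOf y X.p) {ξ : flat A Y ⟶ Y}
    (hξ : ξ ≫ y = flatι A Y ≫ coprod.desc X.s y)
    (htriv : flatMap k (𝟙 Y) ≫ ξ = trivialAction K Y) :
    ∃ h : pullback X.p k ⟶ Y, pullback.lift (k ≫ X.s) (𝟙 K) (by simp) ≫ h = 0 ∧
      pullback.lift y 0 (by rw [hy.zero, zero_comp]) ≫ h = 𝟙 Y := by
  -- The universal property of the semidirect product, for the pair `(0, 1)`: it is equivariant
  -- exactly because the restricted action is trivial.
  refine (pullbackPoint X.p k (k ≫ X.s) (by simp)).exists_desc (isKernelOf_pullback_snd k hy)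
    (ξ := flatMap k (𝟙 Y) ≫ ξ) ?_ 0 (𝟙 Y) ?_
  · apply pullback.hom_ext
    · rw [Category.assoc, Category.assoc, pullback.lift_fst, hξ, reassoc_of% flatMap_flatι,
        Category.assoc]
      congr 1
      ext <;> simp [coprod.inl_desc, coprod.inr_desc, pullback.lift_fst]
    · rw [Category.assoc, pullback.lift_snd, comp_zero, Category.assoc, ← flatι_desc K Y]
      congr 1
      ext <;> simp [coprod.inl_desc, coprod.inr_desc, pullback.lift_snd]
  · rw [htriv, Category.comp_id]
    rfl

/-- A retraction onto the kernel of a point that kills the section exhibits the point as a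
product. -/
theorem Point.eq_of_retraction [SemiAbelian C] {A Y T : C} (X : Point A) {y : Y ⟶ X.pt}
    (hy : IsKernelOf y X.p) {h : X.pt ⟶ Y} (hs : X.s ≫ h = 0) (hyh : y ≫ h = 𝟙 Y)
    {f g : T ⟶ X.pt} (hp : f ≫ X.p = g ≫ X.p) (hh : f ≫ h = g ≫ h) : f = g := by
  -- The pair `(X.p, h)` maps `X` to the product point and is the identity of `Y` on kernels, hence
  -- an isomorphism.
  let P : Point A := ⟨A ⨯ Y, prod.fst, prod.lift (𝟙 A) 0, prod.lift_fst _ _⟩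
  let m : X ⟶ P := ⟨prod.lift X.p h, prod.lift_fst _ _, by
    change X.s ≫ prod.lift X.p h = prod.lift (𝟙 A) 0
    ext <;> simp [hs]⟩
  have hym : y ≫ Point.Hom.f m = prod.lift 0 (𝟙 Y) := by
    change y ≫ prod.lift X.p h = _
    ext <;> simp [hy.zero, hyh]
  have : IsIso (Point.Hom.f m) := by
    refine Point.Hom.isIso_of_isKernelOf m hy ?_
    rw [hym]
    refine ⟨prod.lift_fst _ _, inferInstance, fun t ht => ⟨t ≫ prod.snd, ?_⟩⟩
    replace ht : t ≫ prod.fst = 0 := ht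
    ext <;> simp [ht, prod.lift_fst, prod.lift_snd]
  rw [← cancel_mono (Point.Hom.f m)]
  change f ≫ prod.lift X.p h = g ≫ prod.lift X.p h
  ext <;> simp [hp, hh]

/-- If `K` acts trivially on the kernel `Y` of `X`, then `X` carries a descent datum along `q`. -/
theorem exists_descent [StronglySemiAbelian C] {K A Q Y : C} {k : K ⟶ A} {q : A ⟶ Q}
    (hk : IsKernelOf k q) (X : Point A) {y : Y ⟶ X.pt} (hy : IsKernelOf y X.p)
    {ξ : flat A Y ⟶ Y} (hξ : ξ ≫ y = flatι A Y ≫ coprod.desc X.s y)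
    (htriv : flatMap k (𝟙 Y) ≫ ξ = trivialAction K Y) :
    ∃ g : pullback (X.p ≫ q) q ⟶ X.pt,
      g ≫ X.p = pullback.snd (X.p ≫ q) q ∧
      pullback.lift (𝟙 X.pt) X.p (by simp) ≫ g = 𝟙 X.pt ∧
      ∀ {T : C} (a b : T ⟶ A) (hab : (a ≫ X.s) ≫ X.p ≫ q = b ≫ q),
        pullback.lift (a ≫ X.s) b hab ≫ g = b ≫ X.s := by
  obtain ⟨h, hsh, hyh⟩ := exists_retraction_of_trivial k X hy hξ htriv
  have := hk.mono
  have := hy.mono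
  have hsq : X.s ≫ X.p ≫ q = q := by rw [← Category.assoc, X.s_p, Category.id_comp]
  -- `P` is `X ×_Q A`, `E` is `A ×_Q A` and `L` is `X ×_A K`; `b` and `c` are the kernels of `P` and
  -- `E`.
  let P : Point A := pullbackPoint (X.p ≫ q) q X.s hsq
  let E : Point A := pullbackPoint q q (𝟙 A) (Category.id_comp q)
  let L : Point K := pullbackPoint X.p k (k ≫ X.s) (by simp)
  let y' : Y ⟶ L.pt := pullback.lift y 0 (by rw [hy.zero, zero_comp])
  have hy' : IsKernelOf y' L.p := isKernelOf_pullback_snd k hy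
  let x : L.pt ⟶ X.pt := pullback.fst X.p k
  have hxp : x ≫ X.p = L.p ≫ k := pullback.condition
  have hLs : L.s ≫ x = k ≫ X.s := pullback.lift_fst _ _ _
  have hx : IsKernelOf x (X.p ≫ q) := by
    refine ⟨by rw [reassoc_of% hxp, hk.zero, comp_zero],
      inferInstanceAs (Mono (pullback.fst X.p k)), fun t ht => ?_⟩
    obtain ⟨c, hc⟩ := hk.exists_lift (t ≫ X.p) (by rw [Category.assoc, ht])
    exact ⟨pullback.lift t c hc.symm, pullback.lift_fst _ _ _⟩
  let b : L.pt ⟶ P.pt := pullback.lift x 0 (by rw [hx.zero, zero_comp])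
  have hb : IsKernelOf b P.p := isKernelOf_pullback_snd q hx
  have hb₁ : b ≫ pullback.fst (X.p ≫ q) q = x := pullback.lift_fst _ _ _
  let c : K ⟶ E.pt := pullback.lift k 0 (by rw [hk.zero, zero_comp])
  have hc : IsKernelOf c E.p := isKernelOf_pullback_snd q hk
  let m : E ⟶ P := ⟨pullback.lift (pullback.fst q q ≫ X.s) (pullback.snd q q) (by
      rw [Category.assoc, hsq, pullback.condition]), pullback.lift_snd _ _ _, by
    apply pullback.hom_ext
    · change (pullback.lift _ _ _ ≫ pullback.lift _ _ _) ≫ _ = pullback.lift _ _ _ ≫ _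
      simp [pullback.lift_fst, pullback.lift_fst_assoc]
    · change (pullback.lift _ _ _ ≫ pullback.lift _ _ _) ≫ _ = pullback.lift _ _ _ ≫ _
      simp [pullback.lift_snd]⟩
  have hm₁ : Point.Hom.f m ≫ pullback.fst (X.p ≫ q) q = pullback.fst q q ≫ X.s :=
    pullback.lift_fst _ _ _
  have hm₂ : Point.Hom.f m ≫ pullback.snd (X.p ≫ q) q = pullback.snd q q :=
    pullback.lift_snd _ _ _
  have hcm : c ≫ Point.Hom.f m = L.s ≫ b := by
    apply pullback.hom_ext
    · rw [Category.assoc, hm₁, Category.assoc, hb₁, hLs]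
      exact pullback.lift_fst_assoc _ _ _ _
    · rw [Category.assoc, hm₂, Category.assoc]
      exact hc.zero.trans (by rw [show b ≫ pullback.snd (X.p ≫ q) q = 0 from hb.zero, comp_zero])
  have : Mono X.s := mono_of_mono_fac X.s_p
  have : Mono (Point.Hom.f m) := ⟨fun u v huv => by
    apply pullback.hom_ext
    · rw [← cancel_mono X.s, Category.assoc, Category.assoc, ← hm₁, reassoc_of% huv]
    · rw [← hm₂, reassoc_of% huv]⟩
  have : IsSplitEpi h := ⟨⟨y', hyh⟩⟩
  -- The kernel of `h` is the section of `L`, since `L` is a product; by `hcm` this is the kernel of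
  -- `E`, seen in `P`.
  obtain ⟨W, e, w, hw, hbe⟩ := Point.exists_quotient hb m h
    (fun {T} l t hlt => by
      obtain ⟨j, hj⟩ := hc.exists_lift l (by
        rw [← m.w_p, reassoc_of% hlt, hb.zero, comp_zero])
      have := hb.mono
      have : t = j ≫ L.s := by
        rw [← cancel_mono b, ← hlt, Category.assoc, ← hcm, reassoc_of% hj]
      rw [this, Category.assoc, show L.s ≫ h = 0 from hsh, comp_zero])
    (fun {T} t ht => by
      refine ⟨t ≫ L.p ≫ c, ?_⟩
      have : t = (t ≫ L.p) ≫ L.s := by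
        refine L.eq_of_retraction hy' hsh hyh ?_ ?_
        · rw [Category.assoc, L.s_p, Category.comp_id]
        · rw [ht, Category.assoc, show L.s ≫ h = 0 from hsh, comp_zero]
      rw [Category.assoc, Category.assoc, hcm]
      conv_rhs => rw [this]
      simp only [Category.assoc])
  -- The graph `x ↦ (x, p x)`; followed by the quotient `e`, it is an isomorphism on kernels.
  let i : X ⟶ P := ⟨pullback.lift (𝟙 X.pt) X.p (by simp), pullback.lift_snd _ _ _, by
    apply pullback.hom_ext
    · change (X.s ≫ pullback.lift _ _ _) ≫ _ = pullback.lift _ _ _ ≫ _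
      simp [pullback.lift_fst]
    · change (X.s ≫ pullback.lift _ _ _) ≫ _ = pullback.lift _ _ _ ≫ _
      simp [pullback.lift_snd]⟩
  have hyi : y ≫ Point.Hom.f i = y' ≫ b := by
    apply pullback.hom_ext
    · rw [Category.assoc, Category.assoc, hb₁]
      change y ≫ pullback.lift _ _ _ ≫ _ = pullback.lift _ _ _ ≫ pullback.fst _ _
      simp [pullback.lift_fst]
    · rw [Category.assoc, Category.assoc, show b ≫ pullback.snd (X.p ≫ q) q = 0 from hb.zero]
      change y ≫ pullback.lift _ _ _ ≫ _ = _
      simp [pullback.lift_snd, hy.zero]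
  have : IsIso (Point.Hom.f (i ≫ e)) := by
    refine Point.Hom.isIso_of_isKernelOf _ hy ?_
    rw [Point.comp_f, ← Category.assoc, hyi, Category.assoc, hbe, reassoc_of% hyh]
    exact hw
  let g : P.pt ⟶ X.pt := Point.Hom.f e ≫ inv (Point.Hom.f (i ≫ e))
  have hig : Point.Hom.f i ≫ g = 𝟙 X.pt := by
    rw [← Category.assoc, ← Point.comp_f, IsIso.hom_inv_id]
  have hPs : P.s ≫ g = X.s := by
    rw [← i.w_s, Category.assoc, hig, Category.comp_id]
  -- Transport preserves sections: checked on the diagonal of `E` and on its kernel, which `h`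
  -- kills.
  have hm : Point.Hom.f m ≫ g = E.p ≫ X.s := by
    refine E.hom_ext hc ?_ ?_
    · rw [reassoc_of% m.w_s, hPs, reassoc_of% E.s_p]
    · rw [reassoc_of% hcm, reassoc_of% hbe, reassoc_of% (show L.s ≫ h = 0 from hsh),
        reassoc_of% hc.zero]
      simp
  refine ⟨g, ?_, hig, fun a b hab => ?_⟩
  · have hinv : inv (Point.Hom.f (i ≫ e)) ≫ X.p = W.p := by
      rw [IsIso.inv_comp_eq, (i ≫ e).w_p]
    rw [Category.assoc, hinv, e.w_p]
  · have hab' : a ≫ q = b ≫ q := by rwa [Category.assoc, hsq] at hab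
    have : pullback.lift (a ≫ X.s) b hab = pullback.lift a b hab' ≫ Point.Hom.f m := by
      apply pullback.hom_ext
      · rw [Category.assoc, hm₁, pullback.lift_fst, pullback.lift_fst_assoc]
      · rw [Category.assoc, hm₂, pullback.lift_snd, pullback.lift_snd]
    rw [this, Category.assoc, hm]
    exact pullback.lift_snd_assoc _ _ _ _

/-- The cocycle condition of a descent datum on a point. -/
theorem descent_cocycle [SemiAbelian C] {A Q Y : C} {q : A ⟶ Q} (X : Point A) {y : Y ⟶ X.pt}
    (hy : IsKernelOf y X.p) {g : pullback (X.p ≫ q) q ⟶ X.pt}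
    (hgp : g ≫ X.p = pullback.snd (X.p ≫ q) q)
    (hg₁ : pullback.lift (𝟙 X.pt) X.p (by simp) ≫ g = 𝟙 X.pt)
    (hgs : ∀ {T : C} (a b : T ⟶ A) (hab : (a ≫ X.s) ≫ X.p ≫ q = b ≫ q),
      pullback.lift (a ≫ X.s) b hab ≫ g = b ≫ X.s)
    {T : C} (z : T ⟶ pullback (X.p ≫ q) q) (b : T ⟶ A)
    (hb : (z ≫ g) ≫ X.p ≫ q = b ≫ q)
    (hb' : (z ≫ pullback.fst (X.p ≫ q) q) ≫ X.p ≫ q = b ≫ q) :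
    pullback.lift (z ≫ g) b hb ≫ g = pullback.lift (z ≫ pullback.fst (X.p ≫ q) q) b hb' ≫ g := by
  let φ : T ⟶ A := z ≫ pullback.fst (X.p ≫ q) q ≫ X.p
  let a : T ⟶ A := z ≫ pullback.snd (X.p ≫ q) q
  have hφa : φ ≫ q = a ≫ q := by
    simp only [φ, a, Category.assoc, pullback.condition]
  have hφb : φ ≫ q = b ≫ q := by
    rw [← hb']
    simp only [φ, Category.assoc]
  -- `D` carries the generic element of `X` over `φ`. Transporting it to `b` through `a` (`v`) or
  -- directly (`w`) need only be compared on the section and on the kernel `Y`.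
  let D : Point T := pullbackPoint X.p φ (φ ≫ X.s) (by simp)
  let x : D.pt ⟶ X.pt := pullback.fst X.p φ
  have hx : x ≫ X.p = D.p ≫ φ := pullback.condition
  let y' : Y ⟶ D.pt := pullback.lift y 0 (by rw [hy.zero, zero_comp])
  have hy'x : y' ≫ x = y := pullback.lift_fst _ _ _
  have hsx : D.s ≫ x = φ ≫ X.s := pullback.lift_fst _ _ _
  let u : D.pt ⟶ pullback (X.p ≫ q) q := pullback.lift x (D.p ≫ a) (by
    rw [reassoc_of% hx, hφa]
    exact (Category.assoc _ _ _).symm)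
  let w : D.pt ⟶ pullback (X.p ≫ q) q := pullback.lift x (D.p ≫ b) (by
    rw [reassoc_of% hx, hφb]
    exact (Category.assoc _ _ _).symm)
  have hugp : (u ≫ g) ≫ X.p = D.p ≫ a := by
    rw [Category.assoc, hgp]
    exact pullback.lift_snd _ _ _
  let v : D.pt ⟶ pullback (X.p ≫ q) q := pullback.lift (u ≫ g) (D.p ≫ b) (by
    rw [← Category.assoc (u ≫ g), hugp, Category.assoc D.p b, ← hφb, hφa]
    exact Category.assoc _ _ _)
  have hlift {S : C} (f : S ⟶ pullback (X.p ≫ q) q) (r : S ⟶ X.pt) (c : S ⟶ A)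
      (hr : f ≫ pullback.fst (X.p ≫ q) q = r) (hc : f ≫ pullback.snd (X.p ≫ q) q = c)
      (h : r ≫ X.p ≫ q = c ≫ q) : f = pullback.lift r c h := by
    apply pullback.hom_ext
    · rw [hr, pullback.lift_fst]
    · rw [hc, pullback.lift_snd]
  have hu₁ : u ≫ pullback.fst (X.p ≫ q) q = x := pullback.lift_fst _ _ _
  have hu₂ : u ≫ pullback.snd (X.p ≫ q) q = D.p ≫ a := pullback.lift_snd _ _ _
  have hw₁ : w ≫ pullback.fst (X.p ≫ q) q = x := pullback.lift_fst _ _ _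
  have hw₂ : w ≫ pullback.snd (X.p ≫ q) q = D.p ≫ b := pullback.lift_snd _ _ _
  have hv₁ : v ≫ pullback.fst (X.p ≫ q) q = u ≫ g := pullback.lift_fst _ _ _
  have hv₂ : v ≫ pullback.snd (X.p ≫ q) q = D.p ≫ b := pullback.lift_snd _ _ _
  -- On the kernel `g` is the identity: `(y, 0)` is the graph of `X.p` restricted to `y`.
  have hker {f : Y ⟶ pullback (X.p ≫ q) q} (h₁ : f ≫ pullback.fst (X.p ≫ q) q = y)
      (h₂ : f ≫ pullback.snd (X.p ≫ q) q = 0) : f ≫ g = y := by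
    have : f = y ≫ pullback.lift (𝟙 X.pt) X.p (by simp) := by
      apply pullback.hom_ext
      · rw [h₁, Category.assoc, pullback.lift_fst, Category.comp_id]
      · rw [h₂, Category.assoc, pullback.lift_snd, hy.zero]
    rw [this, Category.assoc, hg₁, Category.comp_id]
  have hsec {f : T ⟶ pullback (X.p ≫ q) q} {c d : T ⟶ A}
      (h₁ : f ≫ pullback.fst (X.p ≫ q) q = c ≫ X.s)
      (h₂ : f ≫ pullback.snd (X.p ≫ q) q = d) : f ≫ g = d ≫ X.s := by
    rw [hlift f _ _ h₁ h₂ (by rw [← h₁, ← h₂, Category.assoc, Category.assoc,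
      pullback.condition])]
    exact hgs _ _ _
  have hy'p : y' ≫ D.p = 0 := pullback.lift_snd _ _ _
  have key : v ≫ g = w ≫ g := by
    refine D.hom_ext (isKernelOf_pullback_snd φ hy) ?_ ?_
    · have hsu : D.s ≫ u ≫ g = a ≫ X.s := by
        rw [← Category.assoc]
        exact hsec (by rw [Category.assoc, hu₁, hsx])
          (by rw [Category.assoc, hu₂, ← Category.assoc, D.s_p, Category.id_comp])
      rw [← Category.assoc, ← Category.assoc,
        hsec (f := D.s ≫ v) (c := a) (d := b) (by rw [Category.assoc, hv₁, hsu])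
          (by rw [Category.assoc, hv₂, ← Category.assoc, D.s_p, Category.id_comp]),
        hsec (f := D.s ≫ w) (c := φ) (d := b) (by rw [Category.assoc, hw₁, hsx])
          (by rw [Category.assoc, hw₂, ← Category.assoc, D.s_p, Category.id_comp])]
    · change y' ≫ v ≫ g = y' ≫ w ≫ g
      have hyu : y' ≫ u ≫ g = y := by
        rw [← Category.assoc]
        exact hker (by rw [Category.assoc, hu₁, hy'x])
          (by rw [Category.assoc, hu₂, reassoc_of% hy'p, zero_comp])
      rw [← Category.assoc, ← Category.assoc,
        hker (f := y' ≫ v) (by rw [Category.assoc, hv₁, hyu])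
          (by rw [Category.assoc, hv₂, reassoc_of% hy'p, zero_comp]),
        hker (f := y' ≫ w) (by rw [Category.assoc, hw₁, hy'x])
          (by rw [Category.assoc, hw₂, reassoc_of% hy'p, zero_comp])]
  -- Specialize the generic element to the first component of `z`.
  let d : T ⟶ D.pt := pullback.lift (z ≫ pullback.fst (X.p ≫ q) q) (𝟙 T) (by
    simp only [φ, Category.assoc, Category.id_comp])
  have hdx : d ≫ x = z ≫ pullback.fst (X.p ≫ q) q := pullback.lift_fst _ _ _
  have hdp : d ≫ D.p = 𝟙 T := pullback.lift_snd _ _ _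
  have hdu : d ≫ u = z := by
    apply pullback.hom_ext
    · rw [Category.assoc, hu₁, hdx]
    · rw [Category.assoc, hu₂, reassoc_of% hdp]
  rw [← hlift (d ≫ v) (z ≫ g) b (by rw [Category.assoc, hv₁, reassoc_of% hdu])
      (by rw [Category.assoc, hv₂, reassoc_of% hdp]),
    ← hlift (d ≫ w) (z ≫ pullback.fst (X.p ≫ q) q) b (by rw [Category.assoc, hw₁, hdx])
      (by rw [Category.assoc, hw₂, reassoc_of% hdp]), Category.assoc, key, Category.assoc]

/-- A descent datum along a regular epimorphism is effective. -/
theorem exists_point_of_descent [SemiAbelian C] {A Q Y : C} (q : A ⟶ Q) [IsRegularEpi q]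
    (X : Point A) {y : Y ⟶ X.pt} (hy : IsKernelOf y X.p) {g : pullback (X.p ≫ q) q ⟶ X.pt}
    (hgp : g ≫ X.p = pullback.snd (X.p ≫ q) q)
    (hg₁ : pullback.lift (𝟙 X.pt) X.p (by simp) ≫ g = 𝟙 X.pt)
    (hgs : ∀ {T : C} (a b : T ⟶ A) (hab : (a ≫ X.s) ≫ X.p ≫ q = b ≫ q),
      pullback.lift (a ≫ X.s) b hab ≫ g = b ≫ X.s) :
    ∃ (Z : Point Q) (π : X.pt ⟶ Z.pt), X.s ≫ π = q ≫ Z.s ∧ IsKernelOf (y ≫ π) Z.p := by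
  have := hy.mono
  let r : pullback (X.p ≫ q) q ⟶ X.pt := pullback.fst (X.p ≫ q) q
  have hrg : r ≫ X.p ≫ q = g ≫ X.p ≫ q := by
    rw [reassoc_of% hgp, pullback.condition]
  -- Transporting back to the original fibre undoes `g`; this gives symmetry.
  have hgfst {T : C} (z : T ⟶ pullback (X.p ≫ q) q) (h : (z ≫ g) ≫ X.p ≫ q = (z ≫ r ≫ X.p) ≫ q) :
      pullback.lift (z ≫ g) (z ≫ r ≫ X.p) h ≫ g = z ≫ r := by
    rw [descent_cocycle X hy hgp hg₁ hgs z _ h (by simp only [r, Category.assoc])]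
    have : (pullback.lift (z ≫ pullback.fst (X.p ≫ q) q) (z ≫ r ≫ X.p)
        (by simp only [r, Category.assoc]) : T ⟶ pullback (X.p ≫ q) q) =
          z ≫ r ≫ pullback.lift (𝟙 X.pt) X.p (by simp) := by
      apply pullback.hom_ext <;> simp [pullback.lift_fst, pullback.lift_snd, r]
    rw [this, Category.assoc, Category.assoc, hg₁, Category.comp_id]
  have hequiv : IsEquivalenceRelation r g := by
    let P := pullback g r
    let a : P ⟶ pullback (X.p ≫ q) q := pullback.fst g r
    let b : P ⟶ pullback (X.p ≫ q) q := pullback.snd g r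
    have hab : a ≫ g = b ≫ r := pullback.condition
    have hb : (a ≫ g) ≫ X.p ≫ q = (b ≫ pullback.snd (X.p ≫ q) q) ≫ q := by
      rw [hab, Category.assoc, Category.assoc, pullback.condition]
    have hb' : (a ≫ pullback.fst (X.p ≫ q) q) ≫ X.p ≫ q =
        (b ≫ pullback.snd (X.p ≫ q) q) ≫ q := by
      rw [← hb, Category.assoc, Category.assoc, ← hrg]
    have hsymm : g ≫ X.p ≫ q = (r ≫ X.p) ≫ q := by rw [← hrg, Category.assoc]
    refine EquivalenceRelation.isEquivalenceRelation
      { right_cancellation := fun T f f' h₁ h₂ => ?_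
        r := pullback.lift (𝟙 X.pt) X.p (by simp)
        reflexivity₁ := pullback.lift_fst _ _ _
        reflexivity₂ := hg₁
        s := pullback.lift g (r ≫ X.p) hsymm
        symmetry₁ := pullback.lift_fst _ _ _
        symmetry₂ := ?_
        c := _
        isLimit := limit.isLimit (cospan g r)
        t := pullback.lift (a ≫ r) (b ≫ pullback.snd (X.p ≫ q) q) hb'
        transitivity₁ := pullback.lift_fst _ _ _
        transitivity₂ := ?_ }
    · apply pullback.hom_ext h₁
      rw [← hgp, reassoc_of% h₂]
    · simpa using hgfst (𝟙 _) (by simpa using hsymm)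
    · change pullback.lift (a ≫ r) (b ≫ pullback.snd (X.p ≫ q) q) hb' ≫ g = b ≫ g
      rw [← descent_cocycle X hy hgp hg₁ hgs a _ hb hb']
      congr 1
      apply pullback.hom_ext
      · rw [pullback.lift_fst, hab]
      · rw [pullback.lift_snd]
  obtain ⟨Z, π, hπ, hker⟩ := exists_quotient r g hequiv
  obtain ⟨p, hp⟩ := IsRegularEpi.exists_of_isKernelPair π hker (X.p ≫ q) hrg
  -- `X.s ≫ π` descends along `q` because `g` carries `s a` to `s b` whenever `q a = q b`.
  obtain ⟨s, hs⟩ := IsRegularEpi.exists_of_isKernelPair q (IsKernelPair.of_hasPullback q)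
    (X.s ≫ π) (by
      have hab : (pullback.fst q q ≫ X.s) ≫ X.p ≫ q = pullback.snd q q ≫ q := by
        rw [Category.assoc, ← Category.assoc X.s, X.s_p, Category.id_comp, pullback.condition]
      rw [← Category.assoc, ← Category.assoc, ← hgs _ _ hab, Category.assoc _ g,
        ← hker.w, ← Category.assoc _ r, pullback.lift_fst])
  refine ⟨⟨Z, p, s, ?_⟩, π, hs.symm, ?_⟩
  · rw [← cancel_epi q, reassoc_of% hs, hp, ← Category.assoc, X.s_p, Category.id_comp,
      Category.comp_id]
  -- Related elements of `Y` coincide, as transport within the fibre over `0` is the identity.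
  have hlift0 {T : C} (l : T ⟶ pullback (X.p ≫ q) q) (t : T ⟶ Y) (h₁ : l ≫ r = t ≫ y)
      (h₂ : l ≫ g ≫ X.p = 0) : l ≫ g = t ≫ y := by
    have : l = t ≫ y ≫ pullback.lift (𝟙 X.pt) X.p (by simp) := by
      apply pullback.hom_ext
      · exact h₁.trans (by simp [pullback.lift_fst])
      · rw [Category.assoc, Category.assoc, pullback.lift_snd, hy.zero, comp_zero, ← hgp, h₂]
    rw [this, Category.assoc, Category.assoc, hg₁, Category.comp_id]
  have : Mono (y ≫ π) := ⟨fun {T} u v huv => by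
    let l : T ⟶ pullback (X.p ≫ q) q := hker.lift (u ≫ y) (v ≫ y) (by simpa using huv)
    have hl₁ : l ≫ r = u ≫ y := hker.lift_fst _ _ _
    have hl₂ : l ≫ g = v ≫ y := hker.lift_snd _ _ _
    rw [← cancel_mono y, ← hl₂, hlift0 l u hl₁ (by
      rw [reassoc_of% hl₂, hy.zero, comp_zero])]⟩
  -- Every element of `ker (X.p ≫ q)` can be transported to the fibre over `0`, so is related to an
  -- element of `Y`.
  let κ : kernel (X.p ≫ q) ⟶ X.pt := kernel.ι (X.p ≫ q)
  let l : kernel (X.p ≫ q) ⟶ pullback (X.p ≫ q) q := pullback.lift κ 0 (by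
    rw [kernel.condition, zero_comp])
  obtain ⟨j, hj⟩ := hy.exists_lift (l ≫ g) (by
    rw [Category.assoc, hgp]
    exact pullback.lift_snd _ _ _)
  refine IsKernelOf.of_regularEpi π (l := κ) ?_ ?_ j ?_
  · rw [Category.assoc, hp, ← Category.assoc, hy.zero, zero_comp]
  · rw [hp]
    exact isKernelOf_kernel_ι _
  · rw [reassoc_of% hj, ← hker.w]
    exact pullback.lift_fst_assoc _ _ _ _

end Descent

/-! ### Restriction of actions along morphisms, and the theorem. -/

theorem flatMap_comp {C : Type u} [Category.{v} C] [HasZeroMorphisms C] [HasFiniteLimits C]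
    [HasFiniteCoproducts C] {A B D Y : C} (a : A ⟶ B) (b : B ⟶ D) :
    flatMap a (𝟙 Y) ≫ flatMap b (𝟙 Y) = flatMap (a ≫ b) (𝟙 Y) := by
  rw [← cancel_mono (flatι D Y), Category.assoc, flatMap_flatι, reassoc_of% flatMap_flatι,
    flatMap_flatι]
  simp

/-- `0 ⨿ 1` is `[0, 1]` followed by the second injection, which is the unit composed with `flatι`.
Hence restricting any action along `0` gives the trivial one. -/
theorem flatMap_zero {C : Type u} [Category.{v} C] [HasZeroMorphisms C] [HasFiniteLimits C]
    [HasFiniteCoproducts C] (A B Y : C) :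
    flatMap (0 : A ⟶ B) (𝟙 Y) = trivialAction A Y ≫ flatη B Y := by
  rw [← cancel_mono (flatι B Y), Category.assoc, flatMap_flatι, flatη_flatι, trivialAction,
    Category.assoc]
  congr 1
  ext <;> simp [coprod.inl_desc, coprod.inr_desc]

end SemiAb

theorem proposition5p4 {C : Type u} [Category.{v} C]
    [HasZeroMorphisms C] [SemiAb.StronglySemiAbelian C]
    {K A Q Y : C} (k : K ⟶ A) (q : A ⟶ Q) (hkq : SemiAb.IsShortExact k q)
    (ξ : SemiAb.InternalAction A Y) :
    SemiAb.flatMap k (𝟙 Y) ≫ ξ.act = SemiAb.trivialAction K Y ↔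
      ∃ ζ : SemiAb.InternalAction Q Y, ξ.act = SemiAb.flatMap q (𝟙 Y) ≫ ζ.act := by
  have := hkq.regularEpi
  constructor
  · intro htriv
    obtain ⟨X, y, hy, hξ⟩ := ξ.exists_point
    obtain ⟨g, hgp, hg₁, hgs⟩ := SemiAb.exists_descent
      (SemiAb.isKernelOf_of_isLimit hkq.zero hkq.isKernel.some) X hy hξ htriv
    obtain ⟨Z, π, hsπ, hyπ⟩ := SemiAb.exists_point_of_descent q X hy hgp hg₁ hgs
    obtain ⟨ζ, hζ⟩ := Z.exists_action hyπ
    refine ⟨ζ, ?_⟩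
    have := hyπ.mono
    rw [← cancel_mono (y ≫ π), Category.assoc, hζ, reassoc_of% SemiAb.flatMap_flatι, reassoc_of% hξ]
    congr 1
    ext <;> simp [coprod.inl_desc, coprod.inr_desc, hsπ]
  · rintro ⟨ζ, hζ⟩
    rw [hζ, ← Category.assoc, SemiAb.flatMap_comp, hkq.zero, SemiAb.flatMap_zero, Category.assoc,
      ζ.flatη_act, Category.comp_id]
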